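/- Let $(M,g_M)$ be an $n$-dimensional closed Riemannian manifold, $I\subset\mathbb R$ an open interval, $r\colon I\to(0,\infty)$ a smooth function, and let ${}_rM\times I$ be the warped product, i.e. the manifold $\overline M=M\times I$ with the metric $\overline g=r(z)^2\,\pi_M^*g_M+dz\otimes dz$, where $\pi_M$ is the projection onto $M$ and $z$ the coordinate of $I$. Let $u\colon M\to I$ be smooth, $f\colon M\to\overline M$, $f(p)=(p,u(p))$, its graph map, and $w=\sqrt{(r\circ u)^2+|\mathrm{grad}\,u|^2}$, where $\mathrm{grad}$, $|\cdot|$ and the Laplacian $\Delta^M=\mathrm{div}\,\mathrm{grad}$ are those of $g_M$. Then $$N=\frac1w\Bigl(-\frac1{r\circ u}(\mathrm{grad}\,u)^L+(r\circ u)\,\partial_z\Bigr)$$ (where $X^L$ denotes the lift to $\overline M$ of a tangent vector $X$ of $M$) is a smooth unit normal vector field along $f$ with $dz(N)>0$, and the mean curvature $H$ of the graph with respect to $-N$, that is, the trace with respect to the induced metric $f^*\overline g$ of the second fundamental form $h(X,Y)=\overline g(\overline\nabla^f_XN,df(Y))$, where $\overline\nabla^f$ is the pullback by $f$ of the Levi-Civita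 connection of $\overline g$, is $$H=-\frac{1}{(r\circ u)\,w}\Delta^Mu+\frac{1}{2(r\circ u)\,w^3}\,g_M\bigl(\mathrm{grad}(|\mathrm{grad}\,u|^2),\mathrm{grad}\,u\bigr)+\frac{r'\circ u}{w^3}|\mathrm{grad}\,u|^2+n\,\frac{r'\circ u}{w}.$$ -/

import Mathlib

set_option maxSynthPendingDepth 3

open Manifold
open scoped ContDiff

noncomputable section

namespace WarpedGraph

section General

variable {E : Type*} [NormedAddCommGroup E] [NormedSpace ℝ E]
  {H : Type*} [TopologicalSpace H] {I : ModelWithCorners ℝ E H}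
  {M : Type*} [TopologicalSpace M] [ChartedSpace H M]
  {E' : Type*} [NormedAddCommGroup E'] [NormedSpace ℝ E']
  {H' : Type*} [TopologicalSpace H'] {I' : ModelWithCorners ℝ E' H'}
  {N : Type*} [TopologicalSpace N] [ChartedSpace H' N]

/-- The trace `B^{ij} h_{ij}` of a bilinear form `h` with respect to an inner product `B` on a
finite-dimensional space: the trace of the endomorphism `A` with `B (A v) w = h v w`. -/
def metricTrace (B h : E →L[ℝ] E →L[ℝ] ℝ) : ℝ :=
  LinearMap.trace ℝ E ((B.inverse ∘L h : E →L[ℝ] E) : E →ₗ[ℝ] E)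

/-- The bilinear form `(v, w) ↦ G (A v) (B w)`. -/
def pullForm (G : E' →L[ℝ] E' →L[ℝ] ℝ) (A B : E →L[ℝ] E') : E →L[ℝ] E →L[ℝ] ℝ :=
  G.bilinearComp A B

/-- For a trilinear form `D`, the form `(v, w, z) ↦ (D v w z + D w v z - D z v w) / 2`. -/
def koszulForm (D : E →L[ℝ] (E →L[ℝ] E →L[ℝ] ℝ)) : E →L[ℝ] (E →L[ℝ] E →L[ℝ] ℝ) :=
  letI K : E →L[ℝ] (E →L[ℝ] E →L[ℝ] ℝ) :=
    (ContinuousLinearMap.flipₗᵢ ℝ E E ℝ).toContinuousLinearEquiv.toContinuousLinearMap ∘L D.flip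
  (1 / 2 : ℝ) • (D + D.flip - K)

/-- The gradient of a real function: `g (grad u) v = du v` for all `v`. -/
def grad (g : Π x : M, TangentSpace I x →L[ℝ] TangentSpace I x →L[ℝ] ℝ) (u : M → ℝ) (p : M) :
    TangentSpace I p :=
  (g p).inverse (mfderiv I 𝓘(ℝ, ℝ) u p)

/-- The pullback of a metric under a map, `(f^* g) v w = g (df v) (df w)`. -/
def inducedMetric (g : Π x : N, TangentSpace I' x →L[ℝ] TangentSpace I' x →L[ℝ] ℝ) (f : M → N)
    (p : M) : TangentSpace I p →L[ℝ] TangentSpace I p →L[ℝ] ℝ :=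
  pullForm (E := E) (E' := E') (g (f p)) (mfderiv I I' f p) (mfderiv I I' f p)

variable [IsManifold I 1 M] [IsManifold I' 1 N]

/-- The coefficients `g_{ij}` of a metric, as a function of `q`, in the coordinate frame of the
chart at `x`. -/
def metricCoeff (g : Π x : M, TangentSpace I x →L[ℝ] TangentSpace I x →L[ℝ] ℝ) (x q : M) :
    E →L[ℝ] E →L[ℝ] ℝ :=
  letI A : E →L[ℝ] E := (trivializationAt E (TangentSpace I : M → Type _) x).symmL ℝ q
  pullForm (E := E) (E' := E) (g q) A A

/-- The derivative at `x` of the metric coefficients in the chart at `x`: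
`dMetricCoeff g x v w z = v (g (w, z))` for constant coordinate fields `w`, `z`. -/
def dMetricCoeff (g : Π x : M, TangentSpace I x →L[ℝ] TangentSpace I x →L[ℝ] ℝ) (x : M) :
    E →L[ℝ] E →L[ℝ] E →L[ℝ] ℝ :=
  mfderiv I 𝓘(ℝ, E →L[ℝ] E →L[ℝ] ℝ) (metricCoeff g x) x

/-- Christoffel symbols of the first kind at `x` in the chart at `x`:
`(v (g (w, z)) + w (g (v, z)) - z (g (v, w))) / 2`. -/
def christoffelLower (g : Π x : M, TangentSpace I x →L[ℝ] TangentSpace I x →L[ℝ] ℝ) (x : M) :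
    E →L[ℝ] E →L[ℝ] E →L[ℝ] ℝ :=
  koszulForm (dMetricCoeff g x)

/-- Christoffel symbols of the Levi-Civita connection at `x` in the chart at `x`. -/
def christoffel (g : Π x : M, TangentSpace I x →L[ℝ] TangentSpace I x →L[ℝ] ℝ) (x : M) :
    E →L[ℝ] E →L[ℝ] E :=
  letI sharp : (E →L[ℝ] ℝ) →L[ℝ] E := ContinuousLinearMap.inverse (g x : E →L[ℝ] E →L[ℝ] ℝ)
  (ContinuousLinearMap.compL ℝ E (E →L[ℝ] ℝ) E sharp) ∘L christoffelLower g x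

/-- The pullback by `f : M → N` of the Levi-Civita connection of the metric `g` on `N`, applied to
a vector field `V` along `f`: `(∇^f_v V) = dV(v) + Γ (df v) V`, computed at `p` in the chart of `N`
at `f p`. The tangent space at `f p` is identified with the model space by that same chart. -/
def covDerivAlong (g : Π x : N, TangentSpace I' x →L[ℝ] TangentSpace I' x →L[ℝ] ℝ) (f : M → N)
    (V : Π q : M, TangentSpace I' (f q)) (p : M) :
    TangentSpace I p →L[ℝ] TangentSpace I' (f p) :=
  letI dV : E →L[ℝ] E' := mfderiv I 𝓘(ℝ, E')
    (fun q ↦ (trivializationAt E' (TangentSpace I' : N → Type _) (f p) ⟨f q, V q⟩).2) p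
  letI df : E →L[ℝ] E' := mfderiv I I' f p
  letI Vp : E' := V p
  dV + (christoffel g (f p)).flip Vp ∘L df

/-- The Laplacian `Δ u = div (grad u) = tr (∇ grad u)`. -/
def laplacian (g : Π x : M, TangentSpace I x →L[ℝ] TangentSpace I x →L[ℝ] ℝ) (u : M → ℝ) (p : M) :
    ℝ :=
  letI A : E →L[ℝ] E := covDerivAlong (I := I) g (fun q : M ↦ q) (grad g u) p
  LinearMap.trace ℝ E (A : E →ₗ[ℝ] E)

/-- `ν` is a smooth unit normal vector field along `f`. -/
structure IsUnitNormalAlong (I : ModelWithCorners ℝ E H)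
    (g : Π x : N, TangentSpace I' x →L[ℝ] TangentSpace I' x →L[ℝ] ℝ) (f : M → N)
    (ν : Π q : M, TangentSpace I' (f q)) : Prop where
  contMDiff : ContMDiff I I'.tangent ∞ (fun q ↦ (⟨f q, ν q⟩ : TangentBundle I' N))
  unit : ∀ p, g (f p) (ν p) (ν p) = 1
  normal : ∀ (p : M) (v : TangentSpace I p), g (f p) (ν p) (mfderiv I I' f p v) = 0

/-- The second fundamental form of `f : M → N` with respect to the unit normal `ν`,
`h v w = - g (∇^f_v ν) (df w)`. -/
def secondFundamentalForm (g : Π x : N, TangentSpace I' x →L[ℝ] TangentSpace I' x →L[ℝ] ℝ)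
    (f : M → N) (ν : Π q : M, TangentSpace I' (f q)) (p : M) :
    TangentSpace I p →L[ℝ] TangentSpace I p →L[ℝ] ℝ :=
  letI h : E →L[ℝ] E →L[ℝ] ℝ :=
    pullForm (E := E) (E' := E') (g (f p)) (covDerivAlong (I := I) g f ν p) (mfderiv I I' f p)
  (-h : E →L[ℝ] E →L[ℝ] ℝ)

/-- The mean curvature of `f : M → N` with respect to the unit normal `ν`: the trace of the second
fundamental form with respect to the induced metric (the sum of the principal curvatures). -/
def meanCurvature (I : ModelWithCorners ℝ E H) [IsManifold I 1 M]
    (g : Π x : N, TangentSpace I' x →L[ℝ] TangentSpace I' x →L[ℝ] ℝ)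
    (f : M → N) (ν : Π q : M, TangentSpace I' (f q)) (p : M) : ℝ :=
  metricTrace (E := E) (inducedMetric (I := I) g f p) (secondFundamentalForm (I := I) g f ν p)

end General

section Warped

variable {E : Type*} [NormedAddCommGroup E] [NormedSpace ℝ E]
  {M : Type*} [TopologicalSpace M] [ChartedSpace E M] {J : TopologicalSpace.Opens ℝ}

/-- The differential `dz` of the coordinate `z` of the second factor of `M × J`. -/
def dz (x : M × J) : TangentSpace (𝓘(ℝ, E).prod 𝓘(ℝ, ℝ)) x →L[ℝ] ℝ :=
  mfderiv (𝓘(ℝ, E).prod 𝓘(ℝ, ℝ)) 𝓘(ℝ, ℝ) (fun y : M × J ↦ (y.2 : ℝ)) x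

/-- The warped product metric `r(z)^2 π_M^* g + dz ⊗ dz` on `M × J`. -/
def warpedMetric (g : Π x : M, TangentSpace 𝓘(ℝ, E) x →L[ℝ] TangentSpace 𝓘(ℝ, E) x →L[ℝ] ℝ)
    (r : ℝ → ℝ) (x : M × J) :
    TangentSpace (𝓘(ℝ, E).prod 𝓘(ℝ, ℝ)) x →L[ℝ]
      TangentSpace (𝓘(ℝ, E).prod 𝓘(ℝ, ℝ)) x →L[ℝ] ℝ :=
  letI dπ : E × ℝ →L[ℝ] E :=
    mfderiv (𝓘(ℝ, E).prod 𝓘(ℝ, ℝ)) 𝓘(ℝ, E) (Prod.fst : M × J → M) x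
  letI ζ : E × ℝ →L[ℝ] ℝ := dz (E := E) x
  r x.2 ^ 2 • pullForm (E := E × ℝ) (E' := E) (g x.1) dπ dπ + ζ.smulRight ζ

/-- The graph map `p ↦ (p, u p)`. -/
def graphMap (u : M → J) (p : M) : M × J := (p, u p)

/-- `|grad u|^2`. -/
def gradSq (g : Π x : M, TangentSpace 𝓘(ℝ, E) x →L[ℝ] TangentSpace 𝓘(ℝ, E) x →L[ℝ] ℝ)
    (u : M → ℝ) (p : M) : ℝ :=
  g p (grad g u p) (grad g u p)

/-- `w = √(r(u)^2 + |grad u|^2)`. -/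
def graphW (g : Π x : M, TangentSpace 𝓘(ℝ, E) x →L[ℝ] TangentSpace 𝓘(ℝ, E) x →L[ℝ] ℝ)
    (r : ℝ → ℝ) (u : M → J) (p : M) : ℝ :=
  √(r (u p) ^ 2 + gradSq g (fun q ↦ (u q : ℝ)) p)

/-- The upward normal field `N = w⁻¹ (- r(u)⁻¹ (grad u)^L + r(u) ∂_z)` along the graph map; the
tangent space of `M × J` at `(p, z)` is the product of `T_p M` and `T_z J = ℝ`. -/
def graphNormal (g : Π x : M, TangentSpace 𝓘(ℝ, E) x →L[ℝ] TangentSpace 𝓘(ℝ, E) x →L[ℝ] ℝ)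
    (r : ℝ → ℝ) (u : M → J) (p : M) :
    TangentSpace (𝓘(ℝ, E).prod 𝓘(ℝ, ℝ)) (graphMap u p) :=
  letI X : E := grad g (fun q ↦ (u q : ℝ)) p
  ((-(1 / (r (u p) * graphW g r u p)) • X, r (u p) / graphW g r u p) : E × ℝ)

end Warped

end WarpedGraph

end

/-! Write `X = grad u`, `α = du` and `c = 1/(r w)`, with `r`, `r'` taken at `u`. Then `-N = c (X,
-r²)`, while `df v = (v, α v)` spans the tangent space of the graph. At each `p` everything is
computed in the chart at `p`, where the warped coefficients are `r(z)² g_ij` plus `dz²`; Koszul's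
formula then gives the Christoffel symbols (`christoffelLower_warpedMetric`). Pairing `∇(-N)` with
`df w` removes the derivative of `c`, because its coefficient `(X, -r²)` is normal to the graph.
What remains involves only the Hessian of `u`, `α ⊗ α` and `g`
(`modelForm_modelCovDeriv_neg_normal`). Raising an index with `g` turns the second fundamental form
into an endomorphism `A`. The induced metric `r² g + α ⊗ α` is a rank-one perturbation of `r² g`, so
Sherman–Morrison gives the trace as `r⁻² (tr A - α(A X) / w²)` (`metricTrace_rank_one`), using `r² +
α X = w²`. The Laplacian comes from `tr A`. The term with `grad |grad u|²` comes from `α(A X)`,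
since metric compatibility makes `d|X|²` twice the Hessian paired with `X` (`inner_hessEndo_grad`).
-/

namespace WarpedGraph

/-! ### Traces with respect to a rank-one perturbed inner product. -/

section LinearAlgebra

variable {E : Type*} [NormedAddCommGroup E] [NormedSpace ℝ E]

/-- A positive definite bilinear form on a finite-dimensional space is nondegenerate. -/
theorem isInvertible_of_pos [FiniteDimensional ℝ E] (B : E →L[ℝ] E →L[ℝ] ℝ)
    (hB : ∀ v, v ≠ 0 → 0 < B v v) : B.IsInvertible := by
  have hinj : Function.Injective (B : E →ₗ[ℝ] E →L[ℝ] ℝ) := by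
    rw [injective_iff_map_eq_zero]
    intro v hv
    by_contra h
    have hpos := hB v h
    have hzero : B v = 0 := hv
    simp [hzero] at hpos
  have hfin : Module.finrank ℝ E = Module.finrank ℝ (E →L[ℝ] ℝ) :=
    (LinearMap.toContinuousLinearMap (𝕜 := ℝ) (E := E) (F' := ℝ)).finrank_eq ▸
      (Subspace.dual_finrank_eq (K := ℝ) (V := E)).symm
  let e := LinearEquiv.ofInjectiveOfFinrankEq (B : E →ₗ[ℝ] E →L[ℝ] ℝ) hinj hfin
  refine ⟨e.toContinuousLinearEquiv, ?_⟩
  ext v w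
  rfl

/-- The trace with respect to a rank-one perturbation `s G + α ⊗ α` of an inner product `G`. -/
theorem metricTrace_rank_one [FiniteDimensional ℝ E] {G B h : E →L[ℝ] E →L[ℝ] ℝ} {A : E →L[ℝ] E}
    {α : E →L[ℝ] ℝ} {X : E} {s : ℝ} (hG : G.IsInvertible) (hX : G X = α) (hs : s ≠ 0)
    (hsα : s + α X ≠ 0) (hB : B = s • G + α.smulRight α) (hh : h = G ∘L A) :
    metricTrace B h =
      s⁻¹ * (LinearMap.trace ℝ E (A : E →ₗ[ℝ] E) - α (A X) / (s + α X)) := by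
  -- Since `G X = α`, the form factors as `B = G ∘ S`; `R` is the Sherman–Morrison inverse of `S`.
  let S : E →L[ℝ] E := s • ContinuousLinearMap.id ℝ E + α.smulRight X
  let R : E →L[ℝ] E := s⁻¹ • (ContinuousLinearMap.id ℝ E - (s + α X)⁻¹ • α.smulRight X)
  have hBS : B = G ∘L S := by
    ext v w
    simp [hB, S, hX]
  have hSR : S ∘L R = .id ℝ E := by
    ext v
    simp only [S, R, ContinuousLinearMap.comp_apply, _root_.add_apply,
      _root_.smul_apply, _root_.sub_apply, ContinuousLinearMap.id_apply,
      ContinuousLinearMap.smulRight_apply, map_smul, map_sub]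
    match_scalars <;> field_simp
    ring
  have hRS : R ∘L S = .id ℝ E := by
    ext v
    simp only [S, R, ContinuousLinearMap.comp_apply, _root_.add_apply,
      _root_.smul_apply, _root_.sub_apply, ContinuousLinearMap.id_apply,
      ContinuousLinearMap.smulRight_apply, map_smul, map_add]
    match_scalars <;> field_simp
    ring
  -- `B⁻¹ h = S⁻¹ G⁻¹ G A`: the form `G` cancels, leaving a trace of endomorphisms.
  have hinv : B.inverse ∘L h = R ∘L A := by
    rw [hBS, hG.inverse_comp_of_left, ContinuousLinearMap.inverse_eq hSR hRS, hh]
    ext v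
    simp [hG.inverse_apply_self]
  have hRA : ((R ∘L A : E →L[ℝ] E) : E →ₗ[ℝ] E) = s⁻¹ • ((A : E →ₗ[ℝ] E) -
      (s + α X)⁻¹ • ((α ∘L A : E →L[ℝ] ℝ) : E →ₗ[ℝ] ℝ).smulRight X) := by
    ext v
    simp [R]
  rw [metricTrace, hinv, hRA]
  simp only [map_smul, map_sub, LinearMap.trace_smulRight]
  simp
  ring_nf
  simp

@[simp]
theorem pullForm_apply {E' : Type*} [NormedAddCommGroup E'] [NormedSpace ℝ E']
    (G : E' →L[ℝ] E' →L[ℝ] ℝ) (A B : E →L[ℝ] E') (v w : E) :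
    pullForm G A B v w = G (A v) (B w) := rfl

@[simp]
theorem koszulForm_apply (D : E →L[ℝ] (E →L[ℝ] E →L[ℝ] ℝ)) (v w z : E) :
    koszulForm D v w z = 1 / 2 * (D v w z + D w v z - D z v w) := rfl

end LinearAlgebra

/-! ### Tangent vectors and metrics in the frame of a fixed chart. -/

section Coordinates

variable {E : Type*} [NormedAddCommGroup E] [NormedSpace ℝ E]
  {H : Type*} [TopologicalSpace H] (I : ModelWithCorners ℝ E H)
  {M : Type*} [TopologicalSpace M] [ChartedSpace H M] [IsManifold I 1 M]

/-- The map `T_q M → E` taking a tangent vector to its coordinates in the chart at `x`. -/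
noncomputable def toCoord (x q : M) : E →L[ℝ] E :=
  (trivializationAt E (TangentSpace I : M → Type _) x).continuousLinearMapAt ℝ q

/-- The map `E → T_q M` taking coordinates in the chart at `x` to the tangent vector. -/
noncomputable def fromCoord (x q : M) : E →L[ℝ] E :=
  (trivializationAt E (TangentSpace I : M → Type _) x).symmL ℝ q

variable {I}

/-- A metric at `q`, as a bilinear form on the model space. -/
noncomputable def modelForm {M : Type*} [TopologicalSpace M] [ChartedSpace H M]
    (g : Π x : M, TangentSpace I x →L[ℝ] TangentSpace I x →L[ℝ] ℝ) (q : M) :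
    E →L[ℝ] E →L[ℝ] ℝ :=
  g q

theorem fromCoord_apply {x q : M} (hq : q ∈ (chartAt H x).source) (v : E) :
    fromCoord I x q v = (trivializationAt E (TangentSpace I : M → Type _) x).symm q v :=
  (trivializationAt E (TangentSpace I : M → Type _) x).symmL_apply (R := ℝ) hq v

theorem toCoord_fromCoord {x q : M} (hq : q ∈ (chartAt H x).source) (v : E) :
    toCoord I x q (fromCoord I x q v) = v :=
  (trivializationAt E (TangentSpace I : M → Type _) x).continuousLinearMapAt_symmL (R := ℝ) hq v

theorem fromCoord_toCoord {x q : M} (hq : q ∈ (chartAt H x).source) (v : E) :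
    fromCoord I x q (toCoord I x q v) = v :=
  (trivializationAt E (TangentSpace I : M → Type _) x).symmL_continuousLinearMapAt (R := ℝ) hq v

theorem toCoord_apply {x q : M} (hq : q ∈ (chartAt H x).source) (v : E) :
    toCoord I x q v = (trivializationAt E (TangentSpace I : M → Type _) x ⟨q, v⟩).2 :=
  (trivializationAt E (TangentSpace I : M → Type _) x).continuousLinearMapAt_apply_of_mem
    ℝ hq v

theorem trivializationAt_snd_eq_tangentCoordChange (x q : M) (v : E) :
    (trivializationAt E (TangentSpace I : M → Type _) x ⟨q, v⟩).2 = tangentCoordChange I q x q v :=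
  rfl

/-- At the centre of the chart the frame is the identity, so values at `x` need no conversion; only
derivatives see how the frame varies. -/
theorem toCoord_self (x : M) (v : E) : toCoord I x x v = v := by
  rw [toCoord_apply (mem_chart_source H x), trivializationAt_snd_eq_tangentCoordChange]
  exact tangentCoordChange_self (mem_extChartAt_source x)

theorem fromCoord_self (x : M) (v : E) : fromCoord I x x v = v := by
  conv_lhs => rw [← toCoord_self (I := I) x v]
  exact fromCoord_toCoord (mem_chart_source H x) v

theorem metricCoeff_apply (g : Π x : M, TangentSpace I x →L[ℝ] TangentSpace I x →L[ℝ] ℝ)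
    (x q : M) (v w : E) :
    metricCoeff g x q v w =
      modelForm g q (fromCoord I x q v) (fromCoord I x q w) :=
  rfl

theorem metricCoeff_self (g : Π x : M, TangentSpace I x →L[ℝ] TangentSpace I x →L[ℝ] ℝ) (x : M) :
    metricCoeff g x x = modelForm g x := by
  refine ContinuousLinearMap.ext fun v ↦ ContinuousLinearMap.ext fun w ↦ ?_
  rw [metricCoeff_apply, fromCoord_self, fromCoord_self]

/-- Smoothness of a section of the bundle of bilinear forms means smoothness of its expression in
trivializations, and near `p` that expression is `metricCoeff`. -/
theorem contMDiffAt_metricCoeff {n : ℕ∞ω} [IsManifold I (n + 1) M]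
    (g : Bundle.ContMDiffRiemannianMetric I n E (fun x : M ↦ TangentSpace I x)) (p : M) :
    ContMDiffAt I 𝓘(ℝ, E →L[ℝ] E →L[ℝ] ℝ) n (metricCoeff g.inner p) p := by
  have h := ((contMDiffAt_hom_bundle _).1 (g.contMDiff p)).2
  refine h.congr_of_eventuallyEq ?_
  filter_upwards [(chartAt H p).open_source.mem_nhds (mem_chart_source H p)] with q hq
  have hb : q ∈ (trivializationAt E (TangentSpace I : M → Type _) p).baseSet := hq
  ext v w
  refine Eq.trans ?_ (inCoordinates_apply_eq₂ hb hb (Set.mem_univ _)).symm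
  -- The forms take values in the trivial line bundle, whose trivialization is the identity on
  -- fibres.
  have key (t : ℝ) : (trivializationAt ℝ (Bundle.Trivial M ℝ) p).linearMapAt ℝ q t = t := by
    exact congrArg (fun A : ℝ →ₗ[ℝ] ℝ ↦ A t) (Bundle.Trivial.linearMapAt_trivialization ℝ M ℝ q)
  rw [metricCoeff_apply, fromCoord_apply hq, fromCoord_apply hq]
  exact (key _).symm

end Coordinates

/-! ### Calculus of vector-valued maps on a manifold. -/

section VectorDerivative

variable {E : Type*} [NormedAddCommGroup E] [NormedSpace ℝ E]
  {H : Type*} [TopologicalSpace H] (I : ModelWithCorners ℝ E H)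
  {M : Type*} [TopologicalSpace M] [ChartedSpace H M]
  {V : Type*} [NormedAddCommGroup V] [NormedSpace ℝ V]
  {W : Type*} [NormedAddCommGroup W] [NormedSpace ℝ W]

/-- The differential at `p` of a map into a vector space, in the chart at `p`. -/
noncomputable def vecDeriv (F : M → V) (p : M) : E →L[ℝ] V :=
  mfderiv I 𝓘(ℝ, V) F p

variable {I}

theorem vecDeriv_eq_of_hasMFDerivAt {F : M → V} {p : M} {F' : E →L[ℝ] V}
    (h : HasMFDerivAt I 𝓘(ℝ, V) F p F') : vecDeriv I F p = F' :=
  HasMFDerivAt.mfderiv h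

theorem vecDeriv_congr {F F' : M → V} {p : M} (h : F =ᶠ[nhds p] F') :
    vecDeriv I F p = vecDeriv I F' p :=
  h.mfderiv_eq

theorem hasMFDerivAt_vecDeriv {F : M → V} {p : M} (hF : MDifferentiableAt I 𝓘(ℝ, V) F p) :
    HasMFDerivAt I 𝓘(ℝ, V) F p (vecDeriv (V := V) I F p) :=
  hF.hasMFDerivAt

/-- The translation and product rules below follow from this chain rule by taking `Φ` to be
translation, scalar multiplication or evaluation. -/
theorem vecDeriv_comp {F : M → V} {p : M} {Φ : V → W} {Φ' : V →L[ℝ] W}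
    (hΦ : HasFDerivAt Φ Φ' (F p)) (hF : MDifferentiableAt I 𝓘(ℝ, V) F p) :
    vecDeriv I (fun q ↦ Φ (F q)) p = Φ' ∘L vecDeriv I F p :=
  vecDeriv_eq_of_hasMFDerivAt (HasMFDerivAt.comp (I' := 𝓘(ℝ, V)) (I'' := 𝓘(ℝ, W)) p
    (hasMFDerivAt_iff_hasFDerivAt.2 hΦ) (hasMFDerivAt_vecDeriv hF))

theorem vecDeriv_prodMk {F : M → V} {F' : M → W} {p : M}
    (hF : MDifferentiableAt I 𝓘(ℝ, V) F p) (hF' : MDifferentiableAt I 𝓘(ℝ, W) F' p) :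
    vecDeriv I (fun q ↦ (F q, F' q)) p = (vecDeriv I F p).prod (vecDeriv I F' p) :=
  vecDeriv_eq_of_hasMFDerivAt ⟨hF.continuousAt.prodMk hF'.continuousAt,
    (hasMFDerivAt_vecDeriv hF).2.prodMk (hasMFDerivAt_vecDeriv hF').2⟩

theorem vecDeriv_add_const {F : M → V} {p : M} (c : V)
    (hF : MDifferentiableAt I 𝓘(ℝ, V) F p) :
    vecDeriv I (fun q ↦ F q + c) p = vecDeriv I F p := by
  rw [vecDeriv_comp (Φ := fun x ↦ x + c) ((hasFDerivAt_id _).add_const c) hF]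
  rfl

theorem vecDeriv_smul {c : M → ℝ} {F : M → V} {p : M}
    (hc : MDifferentiableAt I 𝓘(ℝ, ℝ) c p) (hF : MDifferentiableAt I 𝓘(ℝ, V) F p) (v : E) :
    vecDeriv I (fun q ↦ c q • F q) p v = vecDeriv I c p v • F p + c p • vecDeriv I F p v := by
  rw [vecDeriv_comp (F := fun q ↦ (c q, F q)) (Φ := fun x : ℝ × V ↦ x.1 • x.2)
    (hasFDerivAt_fst.smul hasFDerivAt_snd) (hc.prodMk_space hF), vecDeriv_prodMk hc hF]
  simp [add_comm]

theorem vecDeriv_clm_apply {A : M → V →L[ℝ] W} {F : M → V} {p : M}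
    (hA : MDifferentiableAt I 𝓘(ℝ, V →L[ℝ] W) A p) (hF : MDifferentiableAt I 𝓘(ℝ, V) F p)
    (v : E) :
    vecDeriv I (fun q ↦ A q (F q)) p v = vecDeriv I A p v (F p) + A p (vecDeriv I F p v) := by
  rw [vecDeriv_comp (F := fun q ↦ (A q, F q)) (Φ := fun x : (V →L[ℝ] W) × V ↦ x.1 x.2)
    (hasFDerivAt_fst.clm_apply hasFDerivAt_snd) (hA.prodMk_space hF), vecDeriv_prodMk hA hF]
  simp [add_comm]

/-- The differential of a smooth function is smooth in the coordinates of the chart at `p`. -/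
theorem contMDiffAt_vecDeriv_comp_fromCoord [IsManifold I 1 M] {m n : ℕ∞ω} [IsManifold I n M]
    {u : M → ℝ} {p : M} (hu : ContMDiffAt I 𝓘(ℝ, ℝ) n u p) (hmn : m + 1 ≤ n) :
    ContMDiffAt I 𝓘(ℝ, E →L[ℝ] ℝ) m (fun q ↦ vecDeriv I u q ∘L fromCoord I p q) p := by
  refine (hu.mfderiv_const hmn).congr_of_eventuallyEq (Filter.Eventually.of_forall fun q ↦ ?_)
  refine ContinuousLinearMap.ext fun v ↦ ?_
  exact (congrArg (fun A : ℝ →L[ℝ] ℝ ↦ A (vecDeriv I u q (fromCoord I p q v)))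
    (TangentBundle.continuousLinearMapAt_model_space (𝕜 := ℝ) (u p) (u q))).symm

end VectorDerivative

/-! ### Charts, frames and the warped metric on `M × J`. -/

section Product

/-- All points of an open subset of `ℝ` share one global chart, so the second factor never restricts
a chart domain and its coordinate changes are trivial. -/
theorem chartAt_opens_source {J : TopologicalSpace.Opens ℝ} (z z' : J) :
    z' ∈ (chartAt ℝ z).source :=
  mem_chart_source (H := ℝ) z'

theorem mem_chartAt_source_prod {E : Type*} [TopologicalSpace E] {M : Type*} [TopologicalSpace M]
    [ChartedSpace E M] {J : TopologicalSpace.Opens ℝ} {x y : M × J}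
    (hy : y.1 ∈ (chartAt E x.1).source) : y ∈ (chartAt (ModelProd E ℝ) x).source := by
  rw [prodChartedSpace_chartAt]
  exact ⟨hy, chartAt_opens_source x.2 y.2⟩

variable {E : Type*} [NormedAddCommGroup E] [NormedSpace ℝ E]
  {M : Type*} [TopologicalSpace M] [ChartedSpace E M] {J : TopologicalSpace.Opens ℝ}

theorem tangentCoordChange_opens (x y : J) (t : ℝ) :
    tangentCoordChange 𝓘(ℝ, ℝ) x y x t = t :=
  tangentCoordChange_self (I := 𝓘(ℝ, ℝ)) (x := x) (z := x) (mem_extChartAt_source x)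

theorem hasMFDerivAt_subtype_val (z : J) :
    HasMFDerivAt 𝓘(ℝ, ℝ) 𝓘(ℝ, ℝ) (Subtype.val : J → ℝ) z (ContinuousLinearMap.id ℝ ℝ) := by
  refine ⟨continuous_subtype_val.continuousAt, ?_⟩
  refine (hasFDerivWithinAt_id _ _).congr_of_eventuallyEq ?_ ?_
  · filter_upwards [extChartAt_target_mem_nhdsWithin (I := 𝓘(ℝ, ℝ)) z] with s hs
    exact (extChartAt 𝓘(ℝ, ℝ) z).right_inv hs
  · simp only [writtenInExtChartAt, Function.comp_apply, extChartAt_to_inv]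
    rfl

theorem dz_apply (x : M × J) (v : E × ℝ) : dz (E := E) x v = v.2 := by
  have h := HasMFDerivAt.comp (I := 𝓘(ℝ, E).prod 𝓘(ℝ, ℝ)) (I' := 𝓘(ℝ, ℝ)) (I'' := 𝓘(ℝ, ℝ)) x
    (hasMFDerivAt_subtype_val x.2) (hasMFDerivAt_snd (I := 𝓘(ℝ, E)) (I' := 𝓘(ℝ, ℝ)) x)
  exact congrArg (fun A : E × ℝ →L[ℝ] ℝ ↦ A v) h.mfderiv

theorem warpedMetric_apply
    (g : Π x : M, TangentSpace 𝓘(ℝ, E) x →L[ℝ] TangentSpace 𝓘(ℝ, E) x →L[ℝ] ℝ) (r : ℝ → ℝ)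
    (x : M × J) (v w : E × ℝ) :
    modelForm (warpedMetric g r) x v w = r x.2 ^ 2 * modelForm g x.1 v.1 w.1 + v.2 * w.2 := by
  have h : (mfderiv (𝓘(ℝ, E).prod 𝓘(ℝ, ℝ)) 𝓘(ℝ, E) (Prod.fst : M × J → M) x : E × ℝ →L[ℝ] E) =
    ContinuousLinearMap.fst ℝ E ℝ := mfderiv_fst
  have h' : (dz (E := E) x : E × ℝ →L[ℝ] ℝ) = ContinuousLinearMap.snd ℝ E ℝ :=
    ContinuousLinearMap.ext (dz_apply x)
  unfold modelForm warpedMetric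
  erw [h, h']
  rfl

variable [IsManifold 𝓘(ℝ, E) 1 M]

/-- Transition maps of product charts are products of transition maps. The models have no boundary,
so derivatives are unique and the derivative of the product is the product of the derivatives. -/
theorem trivializationAt_prod (x y : M × J) (hy : y.1 ∈ (chartAt E x.1).source) (v : E) (t : ℝ) :
    (trivializationAt (E × ℝ) (TangentSpace (𝓘(ℝ, E).prod 𝓘(ℝ, ℝ)) : M × J → Type _) x
      ⟨y, ((v, t) : E × ℝ)⟩).2 =
      ((trivializationAt E (TangentSpace 𝓘(ℝ, E) : M → Type _) x.1 ⟨y.1, v⟩).2, t) := by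
  have hx : y ∈ (extChartAt (𝓘(ℝ, E).prod 𝓘(ℝ, ℝ)) x).source := by
    rw [extChartAt_source, prodChartedSpace_chartAt]
    exact ⟨hy, chartAt_opens_source x.2 y.2⟩
  have h1 : HasFDerivWithinAt _ _ _ _ :=
    hasFDerivWithinAt_tangentCoordChange (I := 𝓘(ℝ, E)) (x := y.1) (y := x.1) (z := y.1)
    ⟨mem_extChartAt_source y.1, by rw [extChartAt_source]; exact hy⟩
  have h2 : HasFDerivWithinAt _ _ _ _ :=
    hasFDerivWithinAt_tangentCoordChange (I := 𝓘(ℝ, ℝ)) (x := y.2) (y := x.2) (z := y.2)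
    ⟨mem_extChartAt_source y.2, by rw [extChartAt_source]; exact chartAt_opens_source x.2 y.2⟩
  have h3 : HasFDerivWithinAt _ _ _ _ :=
    hasFDerivWithinAt_tangentCoordChange (I := 𝓘(ℝ, E).prod 𝓘(ℝ, ℝ)) (x := y) (y := x)
    (z := y) ⟨mem_extChartAt_source y, hx⟩
  rw [ModelWithCorners.range_eq_univ, hasFDerivWithinAt_univ] at h1 h2 h3
  have h4 := h3.unique (h1.prodMap (p := extChartAt (𝓘(ℝ, E).prod 𝓘(ℝ, ℝ)) y y) h2)
  have h5 := congrArg (fun A : E × ℝ →L[ℝ] E × ℝ ↦ A (v, t)) h4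
  rw [trivializationAt_snd_eq_tangentCoordChange, trivializationAt_snd_eq_tangentCoordChange]
  exact h5.trans (Prod.ext rfl (tangentCoordChange_opens y.2 x.2 t))

theorem fromCoord_prod (x y : M × J) (hy : y.1 ∈ (chartAt E x.1).source) (v : E × ℝ) :
    fromCoord (𝓘(ℝ, E).prod 𝓘(ℝ, ℝ)) x y v = (fromCoord 𝓘(ℝ, E) x.1 y.1 v.1, v.2) := by
  have h : toCoord (𝓘(ℝ, E).prod 𝓘(ℝ, ℝ)) x y (fromCoord 𝓘(ℝ, E) x.1 y.1 v.1, v.2) = v := by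
    rw [toCoord_apply (mem_chartAt_source_prod hy), trivializationAt_prod x y hy,
      ← toCoord_apply hy, toCoord_fromCoord hy]
  conv_lhs => rw [← h]
  exact fromCoord_toCoord (mem_chartAt_source_prod hy) _

theorem metricCoeff_warpedMetric
    (g : Π x : M, TangentSpace 𝓘(ℝ, E) x →L[ℝ] TangentSpace 𝓘(ℝ, E) x →L[ℝ] ℝ) (r : ℝ → ℝ)
    (x y : M × J) (hy : y.1 ∈ (chartAt E x.1).source) :
    metricCoeff (warpedMetric g r) x y =
      r y.2 ^ 2 • pullForm (metricCoeff g x.1 y.1) (ContinuousLinearMap.fst ℝ E ℝ)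
        (ContinuousLinearMap.fst ℝ E ℝ) +
      (ContinuousLinearMap.snd ℝ E ℝ).smulRight (ContinuousLinearMap.snd ℝ E ℝ) := by
  refine ContinuousLinearMap.ext fun v ↦ ContinuousLinearMap.ext fun w ↦ ?_
  rw [metricCoeff_apply, warpedMetric_apply, fromCoord_prod x y hy, fromCoord_prod x y hy]
  rfl

end Product

/-! ### The covariant derivative along a map, in coordinates. -/

section ModelCovariantDerivative

variable {E : Type*} [NormedAddCommGroup E] [NormedSpace ℝ E]
  {H : Type*} [TopologicalSpace H] {I : ModelWithCorners ℝ E H}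
  {M : Type*} [TopologicalSpace M] [ChartedSpace H M]
  {E' : Type*} [NormedAddCommGroup E'] [NormedSpace ℝ E']
  {H' : Type*} [TopologicalSpace H'] {I' : ModelWithCorners ℝ E' H'}
  {N : Type*} [TopologicalSpace N] [ChartedSpace H' N]

variable (I') in
variable (I) in
/-- The differential of a map, as a linear map of the model spaces. -/
noncomputable def modelDeriv (f : M → N) (p : M) : E →L[ℝ] E' := mfderiv I I' f p

variable [IsManifold I' 1 N]
  (g : Π x : N, TangentSpace I' x →L[ℝ] TangentSpace I' x →L[ℝ] ℝ)

/-- The covariant derivative along a map, as a linear map of the model spaces. -/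
noncomputable def modelCovDeriv (f : M → N) (V : M → E') (p : M) : E →L[ℝ] E' :=
  covDerivAlong (I := I) g f V p

/-- Only the germ of the coordinate expression matters, so any `F` agreeing with it near `p` may be
differentiated; continuity of `f` keeps `f q` in the chart domain at `f p`. -/
theorem modelCovDeriv_apply {f : M → N} {p : M} (hf : ContinuousAt f p) (V : M → E') {F : M → E'}
    (hF : ∀ᶠ q in nhds p, toCoord I' (f p) (f q) (V q) = F q) (v : E) :
    modelCovDeriv (I := I) g f V p v =
      vecDeriv I F p v + christoffel g (f p) (modelDeriv I I' f p v) (V p) := by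
  have h : vecDeriv I (fun q ↦ (trivializationAt E' (TangentSpace I' : N → Type _) (f p)
      ⟨f q, V q⟩).2) p = vecDeriv I F p := by
    refine vecDeriv_congr ?_
    filter_upwards [hF, hf ((chartAt H' (f p)).open_source.mem_nhds (mem_chart_source H' (f p)))]
      with q h1 h2
    exact (toCoord_apply h2 _).symm.trans h1
  rw [← h]
  rfl

/-- `g (Γ(v, w), z)` is the Christoffel symbol of the first kind. -/
theorem modelForm_christoffel {p : N} (hg : (modelForm g p).IsInvertible) (v w z : E') :
    modelForm g p (christoffel g p v w) z = christoffelLower g p v w z :=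
  congrArg (fun A : E' →L[ℝ] ℝ ↦ A z) (hg.self_apply_inverse (christoffelLower g p v w))

end ModelCovariantDerivative

/-! ### The gradient and its covariant derivative. -/

section ModelGradient

variable {E : Type*} [NormedAddCommGroup E] [NormedSpace ℝ E]
  {H : Type*} [TopologicalSpace H] {I : ModelWithCorners ℝ E H}
  {M : Type*} [TopologicalSpace M] [ChartedSpace H M]

/-- The gradient at `q`, as a vector of the model space. -/
noncomputable def modelGrad (g : Π x : M, TangentSpace I x →L[ℝ] TangentSpace I x →L[ℝ] ℝ)
    (u : M → ℝ) (q : M) : E :=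
  grad g u q

end ModelGradient

section Gradient

variable {E : Type*} [NormedAddCommGroup E] [NormedSpace ℝ E]
  {H : Type*} [TopologicalSpace H] {I : ModelWithCorners ℝ E H}
  {M : Type*} [TopologicalSpace M] [ChartedSpace H M] [IsManifold I 1 M] {n : ℕ∞ω}
  (g : Bundle.ContMDiffRiemannianMetric I n E (fun x : M ↦ TangentSpace I x))

theorem isInvertible_inner [FiniteDimensional ℝ E] (q : M) : (modelForm g.inner q).IsInvertible :=
  isInvertible_of_pos (modelForm g.inner q) (g.pos q)

theorem isInvertible_metricCoeff [FiniteDimensional ℝ E] {p q : M} (hq : q ∈ (chartAt H p).source) :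
    (metricCoeff g.inner p q).IsInvertible := by
  refine isInvertible_of_pos _ fun v hv ↦ g.pos q _ fun h ↦ hv ?_
  rw [← toCoord_fromCoord (I := I) hq v]
  have h' : fromCoord I p q v = 0 := h
  rw [h', map_zero]

theorem inner_grad [FiniteDimensional ℝ E] (u : M → ℝ) (q : M) (v : E) :
    modelForm g.inner q (modelGrad g.inner u q) v = vecDeriv I u q v :=
  congrArg (fun A : E →L[ℝ] ℝ ↦ A v)
    ((isInvertible_inner g q).self_apply_inverse (vecDeriv I u q))

/-- The coordinates of the gradient in the chart at `p`. -/
noncomputable def gradCoord (u : M → ℝ) (p q : M) : E := toCoord I p q (modelGrad g.inner u q)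

theorem gradCoord_self (u : M → ℝ) (p : M) : gradCoord g u p p = modelGrad g.inner u p :=
  toCoord_self p _

theorem metricCoeff_gradCoord [FiniteDimensional ℝ E] (u : M → ℝ) {p q : M}
    (hq : q ∈ (chartAt H p).source) :
    metricCoeff g.inner p q (gradCoord g u p q) = vecDeriv I u q ∘L fromCoord I p q := by
  ext v
  rw [metricCoeff_apply, gradCoord, fromCoord_toCoord hq]
  exact inner_grad g u q _

theorem gradCoord_eq [FiniteDimensional ℝ E] (u : M → ℝ) {p q : M} (hq : q ∈ (chartAt H p).source) :
    gradCoord g u p q =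
      (metricCoeff g.inner p q).inverse (vecDeriv I u q ∘L fromCoord I p q) := by
  rw [← metricCoeff_gradCoord g u hq, (isInvertible_metricCoeff g hq).inverse_apply_self]

/-- In coordinates the gradient is `g^{ij} ∂_j u`: inversion is smooth at invertible maps, and `du`
costs one derivative of `u`. -/
theorem contMDiffAt_gradCoord [FiniteDimensional ℝ E] [IsManifold I (n + 1) M] {u : M → ℝ} {p : M}
    (hu : ContMDiffAt I 𝓘(ℝ, ℝ) (n + 1) u p) :
    ContMDiffAt I 𝓘(ℝ, E) n (gradCoord g u p) p := by
  have h1 : ContMDiffAt I 𝓘(ℝ, (E →L[ℝ] ℝ) →L[ℝ] E) n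
      (fun q ↦ (metricCoeff g.inner p q).inverse) p :=
    ContMDiffAt.comp p (I' := 𝓘(ℝ, E →L[ℝ] E →L[ℝ] ℝ))
      (isInvertible_metricCoeff g (mem_chart_source H p)).contDiffAt_map_inverse.contMDiffAt
      (contMDiffAt_metricCoeff g p)
  refine (h1.clm_apply (contMDiffAt_vecDeriv_comp_fromCoord hu le_rfl)).congr_of_eventuallyEq ?_
  filter_upwards [(chartAt H p).open_source.mem_nhds (mem_chart_source H p)] with q hq
  exact gradCoord_eq g u hq

theorem inner_grad_grad_eq (u : M → ℝ) {p q : M} (hq : q ∈ (chartAt H p).source) :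
    modelForm g.inner q (modelGrad g.inner u q) (modelGrad g.inner u q) =
      metricCoeff g.inner p q (gradCoord g u p q) (gradCoord g u p q) := by
  rw [metricCoeff_apply, gradCoord, fromCoord_toCoord hq]

/-- The covariant derivative of the gradient, as an endomorphism of the model space. -/
noncomputable def hessEndo (u : M → ℝ) (p : M) : E →L[ℝ] E :=
  modelCovDeriv (I := I) g.inner (fun q : M ↦ q) (modelGrad g.inner u) p

theorem hessEndo_apply (u : M → ℝ) (p : M) (v : E) :
    hessEndo g u p v = vecDeriv I (gradCoord g u p) p v +
      christoffel g.inner p v (modelGrad g.inner u p) := by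
  rw [hessEndo, modelCovDeriv_apply g.inner (f := fun q ↦ q) continuousAt_id _ (F := gradCoord g u p)
    (Filter.Eventually.of_forall fun q ↦ rfl)]
  have h : modelDeriv I I (fun q : M ↦ q) p = ContinuousLinearMap.id ℝ E := mfderiv_id
  rw [h]
  rfl

/-- Twice the Hessian of `u` applied to `v` and the gradient is the derivative of the squared
norm of the gradient in direction `v`. -/
theorem inner_hessEndo_grad [FiniteDimensional ℝ E] [IsManifold I (n + 1) M] (hn : n ≠ 0)
    {u : M → ℝ} {p : M}
    (hu : ContMDiffAt I 𝓘(ℝ, ℝ) (n + 1) u p) (v : E) :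
    vecDeriv I (fun q ↦ modelForm g.inner q (modelGrad g.inner u q) (modelGrad g.inner u q)) p v =
      2 * modelForm g.inner p (hessEndo g u p v) (modelGrad g.inner u p) := by
  have hX := (contMDiffAt_gradCoord g hu).mdifferentiableAt hn
  have hG := (contMDiffAt_metricCoeff g p).mdifferentiableAt hn
  have h1 : vecDeriv I
      (fun q ↦ modelForm g.inner q (modelGrad g.inner u q) (modelGrad g.inner u q)) p =
      vecDeriv I (fun q ↦ metricCoeff g.inner p q (gradCoord g u p q) (gradCoord g u p q)) p := by
    refine vecDeriv_congr ?_
    filter_upwards [(chartAt H p).open_source.mem_nhds (mem_chart_source H p)] with q hq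
    exact inner_grad_grad_eq g u hq
  rw [h1, vecDeriv_clm_apply (hG.clm_apply hX) hX, vecDeriv_clm_apply hG hX, hessEndo_apply,
    metricCoeff_self, gradCoord_self, map_add, _root_.add_apply, _root_.add_apply,
    modelForm_christoffel _ (isInvertible_inner g p)]
  -- With equal second and third arguments, two of the three Koszul terms cancel. This is metric
  -- compatibility.
  have h2 : christoffelLower g.inner p v (modelGrad g.inner u p) (modelGrad g.inner u p) =
      1 / 2 * vecDeriv I (metricCoeff g.inner p) p v (modelGrad g.inner u p)
        (modelGrad g.inner u p) := by
    rw [christoffelLower, koszulForm_apply, add_sub_cancel_right]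
    rfl
  have h3 : modelForm g.inner p (modelGrad g.inner u p) (vecDeriv I (gradCoord g u p) p v) =
    modelForm g.inner p (vecDeriv I (gradCoord g u p) p v) (modelGrad g.inner u p) :=
    g.symm p _ _
  rw [h2, h3]
  ring

end Gradient

/-! ### Christoffel symbols of the warped product. -/

section WarpedChristoffel

variable {E : Type*} [NormedAddCommGroup E] [NormedSpace ℝ E]
  {M : Type*} [TopologicalSpace M] [ChartedSpace E M] {J : TopologicalSpace.Opens ℝ}

variable (E) in
/-- Pullback of bilinear forms from `E` to `E × ℝ` by the projection, as a continuous linear map. -/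
noncomputable def pullFst :
    (E →L[ℝ] E →L[ℝ] ℝ) →L[ℝ] (E × ℝ →L[ℝ] E × ℝ →L[ℝ] ℝ) :=
  (ContinuousLinearMap.compL ℝ (E × ℝ) E (E × ℝ →L[ℝ] ℝ)).flip (ContinuousLinearMap.fst ℝ E ℝ) ∘L
    ContinuousLinearMap.compL ℝ E (E →L[ℝ] ℝ) (E × ℝ →L[ℝ] ℝ)
      ((ContinuousLinearMap.compL ℝ (E × ℝ) E ℝ).flip (ContinuousLinearMap.fst ℝ E ℝ))

variable {V : Type*} [NormedAddCommGroup V] [NormedSpace ℝ V]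

theorem hasMFDerivAt_comp_fst {F : M → V} {x : M × J}
    (hF : MDifferentiableAt 𝓘(ℝ, E) 𝓘(ℝ, V) F x.1) :
    HasMFDerivAt (𝓘(ℝ, E).prod 𝓘(ℝ, ℝ)) 𝓘(ℝ, V) (fun y : M × J ↦ F y.1) x
      (vecDeriv 𝓘(ℝ, E) F x.1 ∘L ContinuousLinearMap.fst ℝ E ℝ : E × ℝ →L[ℝ] V) :=
  HasMFDerivAt.comp (I := 𝓘(ℝ, E).prod 𝓘(ℝ, ℝ)) (I' := 𝓘(ℝ, E)) (I'' := 𝓘(ℝ, V)) x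
    (hasMFDerivAt_vecDeriv hF) (hasMFDerivAt_fst (I := 𝓘(ℝ, E)) (I' := 𝓘(ℝ, ℝ)) x)

theorem hasMFDerivAt_comp_coord {φ : ℝ → V} {φ' : V} {x : M × J} (hφ : HasDerivAt φ φ' x.2) :
    HasMFDerivAt (𝓘(ℝ, E).prod 𝓘(ℝ, ℝ)) 𝓘(ℝ, V) (fun y : M × J ↦ φ y.2) x
      ((ContinuousLinearMap.snd ℝ E ℝ).smulRight φ' : E × ℝ →L[ℝ] V) := by
  have h1 := HasMFDerivAt.comp (I := 𝓘(ℝ, E).prod 𝓘(ℝ, ℝ)) (I' := 𝓘(ℝ, ℝ)) (I'' := 𝓘(ℝ, ℝ)) x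
    (hasMFDerivAt_subtype_val x.2) (hasMFDerivAt_snd (I := 𝓘(ℝ, E)) (I' := 𝓘(ℝ, ℝ)) x)
  have h2 := HasMFDerivAt.comp (I := 𝓘(ℝ, E).prod 𝓘(ℝ, ℝ)) (I' := 𝓘(ℝ, ℝ)) (I'' := 𝓘(ℝ, V)) x
    (hasMFDerivAt_iff_hasFDerivAt.2 hφ.hasFDerivAt) h1
  exact h2

variable [IsManifold 𝓘(ℝ, E) 1 M]
  {g : Π x : M, TangentSpace 𝓘(ℝ, E) x →L[ℝ] TangentSpace 𝓘(ℝ, E) x →L[ℝ] ℝ}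
  {r : ℝ → ℝ} {x : M × J}

/-- Product rule for `r(z)² g_ij`: the `z` component of `v` differentiates only `r²`, the `M`
component only `g`, and the `dz²` block is constant. -/
theorem dMetricCoeff_warpedMetric
    (hg : MDifferentiableAt 𝓘(ℝ, E) 𝓘(ℝ, E →L[ℝ] E →L[ℝ] ℝ) (metricCoeff g x.1) x.1)
    (hr : DifferentiableAt ℝ r x.2) (v w y : E × ℝ) :
    dMetricCoeff (warpedMetric g r) x v w y =
      v.2 * (2 * r x.2 * deriv r x.2) * modelForm g x.1 w.1 y.1 +
        r x.2 ^ 2 * dMetricCoeff g x.1 v.1 w.1 y.1 := by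
  have hr2 : HasDerivAt (fun t ↦ r t ^ 2) (2 * r x.2 * deriv r x.2) x.2 := by
    simpa using hr.hasDerivAt.fun_pow 2
  have h1 := hasMFDerivAt_comp_coord (E := E) (M := M) hr2
  have h2 := hasMFDerivAt_comp_fst (J := J) hg
  -- Pulling back by the projection is the fixed continuous linear map `pullFst`, so it commutes
  -- with differentiation.
  have h3 : (metricCoeff (warpedMetric g r) x) =ᶠ[nhds x] fun y : M × J ↦
      r y.2 ^ 2 • pullFst E (metricCoeff g x.1 y.1) +
        (ContinuousLinearMap.snd ℝ E ℝ).smulRight (ContinuousLinearMap.snd ℝ E ℝ) := by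
    filter_upwards [continuousAt_fst.preimage_mem_nhds
      ((chartAt E x.1).open_source.mem_nhds (mem_chart_source E x.1))] with y hy
    exact metricCoeff_warpedMetric g r x y hy
  have h4 : MDifferentiableAt (𝓘(ℝ, E).prod 𝓘(ℝ, ℝ)) 𝓘(ℝ, E × ℝ →L[ℝ] E × ℝ →L[ℝ] ℝ)
      (fun y : M × J ↦ pullFst E (metricCoeff g x.1 y.1)) x :=
    (pullFst E).differentiableAt.comp_mdifferentiableAt h2.mdifferentiableAt
  have h5 := vecDeriv_comp (pullFst E).hasFDerivAt h2.mdifferentiableAt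
  have h6 : dMetricCoeff (warpedMetric g r) x = vecDeriv (𝓘(ℝ, E).prod 𝓘(ℝ, ℝ))
      (metricCoeff (warpedMetric g r) x) x := rfl
  rw [h6, vecDeriv_congr h3, vecDeriv_add_const (F := fun y : M × J ↦
      r y.2 ^ 2 • pullFst E (metricCoeff g x.1 y.1)) _ (h1.mdifferentiableAt.smul h4),
    vecDeriv_smul h1.mdifferentiableAt h4, h5, vecDeriv_eq_of_hasMFDerivAt h1,
    vecDeriv_eq_of_hasMFDerivAt h2, metricCoeff_self]
  rfl

theorem christoffelLower_warpedMetric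
    (hg : MDifferentiableAt 𝓘(ℝ, E) 𝓘(ℝ, E →L[ℝ] E →L[ℝ] ℝ) (metricCoeff g x.1) x.1)
    (hr : DifferentiableAt ℝ r x.2) (v w y : E × ℝ) :
    christoffelLower (warpedMetric g r) x v w y =
      r x.2 ^ 2 * christoffelLower g x.1 v.1 w.1 y.1 +
        r x.2 * deriv r x.2 * (v.2 * modelForm g x.1 w.1 y.1 + w.2 * modelForm g x.1 v.1 y.1 -
          y.2 * modelForm g x.1 v.1 w.1) := by
  rw [christoffelLower, christoffelLower, koszulForm_apply, koszulForm_apply,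
    dMetricCoeff_warpedMetric hg hr, dMetricCoeff_warpedMetric hg hr,
    dMetricCoeff_warpedMetric hg hr]
  ring

end WarpedChristoffel

/-! ### The graph map and its unit normal. -/

section Graph

variable {E : Type*} [NormedAddCommGroup E] [NormedSpace ℝ E]
  {M : Type*} [TopologicalSpace M] [ChartedSpace E M]
  {J : TopologicalSpace.Opens ℝ} {r : ℝ → ℝ} {u : M → J}

theorem contMDiff_comp_of_contDiffOn (hr : ContDiffOn ℝ ∞ r J)
    (hu : ContMDiff 𝓘(ℝ, E) 𝓘(ℝ, ℝ) ∞ u) :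
    ContMDiff 𝓘(ℝ, E) 𝓘(ℝ, ℝ) ∞ (fun q ↦ r (u q)) := by
  intro p
  have h1 : ContMDiffAt 𝓘(ℝ, ℝ) 𝓘(ℝ, ℝ) ∞ r (u p : ℝ) :=
    (hr.contDiffAt (J.isOpen.mem_nhds (u p).2)).contMDiffAt
  exact h1.comp p ((contMDiff_subtype_val.comp hu) p)

theorem vecDeriv_coe_eq {p : M} (hu : MDifferentiableAt 𝓘(ℝ, E) 𝓘(ℝ, ℝ) u p) :
    vecDeriv 𝓘(ℝ, E) (fun q ↦ (u q : ℝ)) p = modelDeriv 𝓘(ℝ, E) 𝓘(ℝ, ℝ) u p :=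
  vecDeriv_eq_of_hasMFDerivAt (HasMFDerivAt.comp (I' := 𝓘(ℝ, ℝ)) (I'' := 𝓘(ℝ, ℝ)) p
    (hasMFDerivAt_subtype_val (u p)) hu.hasMFDerivAt)

theorem modelDeriv_graphMap {p : M} (hu : MDifferentiableAt 𝓘(ℝ, E) 𝓘(ℝ, ℝ) u p) (v : E) :
    modelDeriv 𝓘(ℝ, E) (𝓘(ℝ, E).prod 𝓘(ℝ, ℝ)) (graphMap u) p v =
      (v, vecDeriv 𝓘(ℝ, E) (fun q ↦ (u q : ℝ)) p v) := by
  rw [vecDeriv_coe_eq hu]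
  have h := (hasMFDerivAt_id (I := 𝓘(ℝ, E)) p).prodMk hu.hasMFDerivAt
  exact congrArg (fun A : E →L[ℝ] E × ℝ ↦ A v) h.mfderiv

variable [IsManifold 𝓘(ℝ, E) ∞ M]

theorem toCoord_graph (p : M) {q : M} (hq : q ∈ (chartAt E p).source) (v : E) (t : ℝ) :
    toCoord (𝓘(ℝ, E).prod 𝓘(ℝ, ℝ)) (graphMap u p) (graphMap u q) (v, t) =
      (toCoord 𝓘(ℝ, E) p q v, t) := by
  rw [toCoord_apply (mem_chartAt_source_prod (x := graphMap u p) (y := graphMap u q) hq),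
    toCoord_apply hq]
  exact trivializationAt_prod (graphMap u p) (graphMap u q) hq v t

variable
  (g : Bundle.ContMDiffRiemannianMetric 𝓘(ℝ, E) ∞ E (fun x : M ↦ TangentSpace 𝓘(ℝ, E) x))

theorem contMDiffAt_metricCoeff_infty (p : M) :
    ContMDiffAt 𝓘(ℝ, E) 𝓘(ℝ, E →L[ℝ] E →L[ℝ] ℝ) ∞ (metricCoeff g.inner p) p :=
  -- `∞ + 1` is `∞` by definition, so the extra derivative comes free.
  haveI : IsManifold 𝓘(ℝ, E) (∞ + 1) M := ‹_›
  contMDiffAt_metricCoeff (n := ∞) g p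

theorem gradSq_eq (U : M → ℝ) (p : M) :
    gradSq g.inner U p = modelForm g.inner p (modelGrad g.inner U p) (modelGrad g.inner U p) :=
  rfl

theorem gradSq_nonneg (U : M → ℝ) (p : M) : 0 ≤ gradSq g.inner U p := by
  by_cases h : grad g.inner U p = 0
  · simp [gradSq, h]
  · exact (g.pos p _ h).le

theorem graphW_pos (hr_pos : ∀ z ∈ J, 0 < r z) (p : M) : 0 < graphW g.inner r u p :=
  Real.sqrt_pos.2 (add_pos_of_pos_of_nonneg (pow_pos (hr_pos _ (u p).2) 2) (gradSq_nonneg g _ p))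

theorem graphW_sq (hr_pos : ∀ z ∈ J, 0 < r z) (p : M) :
    graphW g.inner r u p ^ 2 = r (u p) ^ 2 + gradSq g.inner (fun q ↦ (u q : ℝ)) p :=
  Real.sq_sqrt (add_pos_of_pos_of_nonneg (pow_pos (hr_pos _ (u p).2) 2) (gradSq_nonneg g _ p)).le

/-- The coefficient `1 / (r(u) w)` of `grad u` in the first component of `-N`. -/
noncomputable def normalCoeff (r : ℝ → ℝ) (u : M → J) (p : M) : ℝ :=
  1 / (r (u p) * graphW g.inner r u p)

/-- Gives both components of the normal the common factor `c`, i.e. `N = c (-X, r²)`; this is what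
later makes the derivative of `c` drop out. -/
theorem div_graphW_eq (hr_pos : ∀ z ∈ J, 0 < r z) (p : M) :
    r (u p) / graphW g.inner r u p = r (u p) ^ 2 * normalCoeff g r u p := by
  have h1 := (hr_pos _ (u p).2).ne'
  have h2 := (graphW_pos g hr_pos (u := u) p).ne'
  rw [normalCoeff]
  field_simp

/-- The normal field as a map into the model space. -/
noncomputable def modelNormal (r : ℝ → ℝ) (u : M → J) (p : M) : E × ℝ :=
  graphNormal g.inner r u p

theorem modelNormal_eq (hr_pos : ∀ z ∈ J, 0 < r z) (p : M) :
    modelNormal g r u p = (-normalCoeff g r u p • modelGrad g.inner (fun q ↦ (u q : ℝ)) p,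
      r (u p) ^ 2 * normalCoeff g r u p) := by
  rw [← div_graphW_eq g hr_pos]
  rfl

theorem dz_graphNormal_pos (hr_pos : ∀ z ∈ J, 0 < r z) (p : M) :
    0 < dz (graphMap u p) (graphNormal g.inner r u p) := by
  have h : 0 < dz (E := E) (graphMap u p) (modelNormal g r u p) := by
    rw [dz_apply]
    exact div_pos (hr_pos _ (u p).2) (graphW_pos g hr_pos p)
  exact h

variable [FiniteDimensional ℝ E]

theorem contMDiffAt_gradCoord_infty {U : M → ℝ} {p : M} (hU : ContMDiffAt 𝓘(ℝ, E) 𝓘(ℝ, ℝ) ∞ U p) :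
    ContMDiffAt 𝓘(ℝ, E) 𝓘(ℝ, E) ∞ (gradCoord g U p) p :=
  haveI : IsManifold 𝓘(ℝ, E) (∞ + 1) M := ‹_›
  contMDiffAt_gradCoord (n := ∞) g hU

theorem contMDiff_gradSq {U : M → ℝ} (hU : ContMDiff 𝓘(ℝ, E) 𝓘(ℝ, ℝ) ∞ U) :
    ContMDiff 𝓘(ℝ, E) 𝓘(ℝ, ℝ) ∞ (gradSq g.inner U) := by
  intro p
  have hX := contMDiffAt_gradCoord_infty g (hU p)
  refine (((contMDiffAt_metricCoeff_infty g p).clm_apply hX).clm_apply hX).congr_of_eventuallyEq ?_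
  filter_upwards [(chartAt E p).open_source.mem_nhds (mem_chart_source E p)] with q hq
  exact inner_grad_grad_eq g U hq

theorem contMDiff_graphW (hr : ContDiffOn ℝ ∞ r J) (hr_pos : ∀ z ∈ J, 0 < r z)
    (hu : ContMDiff 𝓘(ℝ, E) 𝓘(ℝ, ℝ) ∞ u) :
    ContMDiff 𝓘(ℝ, E) 𝓘(ℝ, ℝ) ∞ (graphW g.inner r u) := by
  intro p
  have hU : ContMDiff 𝓘(ℝ, E) 𝓘(ℝ, ℝ) ∞ (fun q ↦ (u q : ℝ)) := contMDiff_subtype_val.comp hu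
  have h1 : ContMDiffAt 𝓘(ℝ, E) 𝓘(ℝ, ℝ) ∞
      (fun q ↦ r (u q) ^ 2 + gradSq g.inner (fun q ↦ (u q : ℝ)) q) p :=
    ((contMDiff_comp_of_contDiffOn hr hu).pow 2 p).add (contMDiff_gradSq g hU p)
  have h2 : r (u p) ^ 2 + gradSq g.inner (fun q ↦ (u q : ℝ)) p ≠ 0 :=
    (add_pos_of_pos_of_nonneg (pow_pos (hr_pos _ (u p).2) 2) (gradSq_nonneg g _ p)).ne'
  exact ContMDiffAt.comp p (Real.contDiffAt_sqrt h2).contMDiffAt h1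

theorem contMDiff_normalCoeff (hr : ContDiffOn ℝ ∞ r J) (hr_pos : ∀ z ∈ J, 0 < r z)
    (hu : ContMDiff 𝓘(ℝ, E) 𝓘(ℝ, ℝ) ∞ u) :
    ContMDiff 𝓘(ℝ, E) 𝓘(ℝ, ℝ) ∞ (normalCoeff g r u) := by
  intro p
  have h1 : ContMDiffAt 𝓘(ℝ, E) 𝓘(ℝ, ℝ) ∞ (fun q ↦ r (u q) * graphW g.inner r u q) p :=
    ((contMDiff_comp_of_contDiffOn hr hu).mul (contMDiff_graphW g hr hr_pos hu)) p
  have h2 : r (u p) * graphW g.inner r u p ≠ 0 :=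
    (mul_pos (hr_pos _ (u p).2) (graphW_pos g hr_pos p)).ne'
  have h3 : ContDiffAt ℝ ∞ (fun t : ℝ ↦ 1 / t) (r (u p) * graphW g.inner r u p) :=
    contDiffAt_const.div contDiffAt_id h2
  exact ContMDiffAt.comp p h3.contMDiffAt h1

theorem contMDiff_graphNormal (hr : ContDiffOn ℝ ∞ r J) (hr_pos : ∀ z ∈ J, 0 < r z)
    (hu : ContMDiff 𝓘(ℝ, E) 𝓘(ℝ, ℝ) ∞ u) :
    ContMDiff 𝓘(ℝ, E) (𝓘(ℝ, E).prod 𝓘(ℝ, ℝ)).tangent ∞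
      (fun q ↦ (⟨graphMap u q, graphNormal g.inner r u q⟩ :
        TangentBundle (𝓘(ℝ, E).prod 𝓘(ℝ, ℝ)) (M × J))) := by
  intro p
  have hf : ContMDiff 𝓘(ℝ, E) (𝓘(ℝ, E).prod 𝓘(ℝ, ℝ)) ∞ (graphMap u) := contMDiff_id.prodMk hu
  have hU : ContMDiff 𝓘(ℝ, E) 𝓘(ℝ, ℝ) ∞ (fun q ↦ (u q : ℝ)) := contMDiff_subtype_val.comp hu
  have hc := contMDiff_normalCoeff g hr hr_pos hu
  refine Bundle.contMDiffAt_totalSpace.2 ⟨hf p, ?_⟩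
  have h1 : ContMDiffAt 𝓘(ℝ, E) 𝓘(ℝ, E × ℝ) ∞
      (fun q ↦ (-normalCoeff g r u q • gradCoord g (fun q ↦ (u q : ℝ)) p q,
        r (u q) ^ 2 * normalCoeff g r u q)) p :=
    ((hc p).neg.smul (contMDiffAt_gradCoord_infty g (hU p))).prodMk_space
      (((contMDiff_comp_of_contDiffOn hr hu).pow 2 p).mul (hc p))
  refine h1.congr_of_eventuallyEq ?_
  filter_upwards [(chartAt E p).open_source.mem_nhds (mem_chart_source E p)] with q hq
  refine (toCoord_apply (mem_chartAt_source_prod (x := graphMap u p) (y := graphMap u q) hq)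
    (modelNormal g r u q)).symm.trans ?_
  rw [modelNormal_eq g hr_pos, toCoord_graph p hq, map_smul, gradCoord]

/-- The squared length is `c² r² (|X|² + r²) = c² r² w² = 1`, and the product with `(v, du v)` is
`-r² c du(v) + r² c du(v) = 0`. -/
theorem isUnitNormalAlong_graphNormal (hr : ContDiffOn ℝ ∞ r J) (hr_pos : ∀ z ∈ J, 0 < r z)
    (hu : ContMDiff 𝓘(ℝ, E) 𝓘(ℝ, ℝ) ∞ u) :
    IsUnitNormalAlong 𝓘(ℝ, E) (warpedMetric g.inner r) (graphMap u) (graphNormal g.inner r u) where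
  contMDiff := contMDiff_graphNormal g hr hr_pos hu
  unit p := by
    have h : modelForm (warpedMetric g.inner r) (graphMap u p) (modelNormal g r u p)
        (modelNormal g r u p) = 1 := by
      rw [warpedMetric_apply, modelNormal_eq g hr_pos]
      simp only [graphMap, map_smul, _root_.smul_apply, smul_eq_mul]
      rw [← gradSq_eq]
      have h1 := (hr_pos _ (u p).2).ne'
      have h2 := (graphW_pos g hr_pos (u := u) p).ne'
      have h3 := graphW_sq g hr_pos (u := u) p
      rw [normalCoeff]
      field_simp
      rw [h3]
      ring
    exact h
  normal p v := by
    have h (v : E) : modelForm (warpedMetric g.inner r) (graphMap u p) (modelNormal g r u p)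
        (modelDeriv 𝓘(ℝ, E) (𝓘(ℝ, E).prod 𝓘(ℝ, ℝ)) (graphMap u) p v) = 0 := by
      rw [warpedMetric_apply, modelNormal_eq g hr_pos,
        modelDeriv_graphMap (hu.mdifferentiable (by simp) p)]
      simp only [graphMap, map_smul, _root_.smul_apply, smul_eq_mul]
      rw [inner_grad]
      ring
    exact h v

theorem isInvertible_warpedMetric (hr_pos : ∀ z ∈ J, 0 < r z) (x : M × J) :
    (modelForm (warpedMetric g.inner r) x).IsInvertible := by
  refine isInvertible_of_pos _ fun v hv ↦ ?_
  rw [warpedMetric_apply]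
  have hr := pow_pos (hr_pos _ x.2.2) 2
  by_cases h1 : v.1 = 0
  · have h2 : v.2 ≠ 0 := fun h2 ↦ hv (Prod.ext h1 h2)
    rw [h1, map_zero]
    simpa using h2
  · have h3 : 0 < modelForm g.inner x.1 v.1 v.1 := g.pos x.1 _ h1
    have := mul_pos hr h3
    nlinarith [mul_self_nonneg v.2]

end Graph

/-! ### Second fundamental form and mean curvature of the graph. -/

section GraphCurvature

variable {E : Type*} [NormedAddCommGroup E] [NormedSpace ℝ E]
  {M : Type*} [TopologicalSpace M] [ChartedSpace E M] [IsManifold 𝓘(ℝ, E) ∞ M]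
  (g : Bundle.ContMDiffRiemannianMetric 𝓘(ℝ, E) ∞ E (fun x : M ↦ TangentSpace 𝓘(ℝ, E) x))
  {J : TopologicalSpace.Opens ℝ} {r : ℝ → ℝ} {u : M → J}

/-- The Christoffel term stays unexpanded: only its pairing with tangent vectors is needed, and that
requires just the symbols of the first kind. -/
theorem modelCovDeriv_neg_normal (hr_pos : ∀ z ∈ J, 0 < r z)
    (hu : ContMDiff 𝓘(ℝ, E) 𝓘(ℝ, ℝ) ∞ u) (p : M) (v : E) :
    modelCovDeriv (I := 𝓘(ℝ, E)) (warpedMetric g.inner r) (graphMap u)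
        (fun q ↦ -modelNormal g r u q) p v =
      vecDeriv 𝓘(ℝ, E) (fun q ↦ (normalCoeff g r u q • gradCoord g (fun q ↦ (u q : ℝ)) p q,
        (-r (u q) ^ 2) • normalCoeff g r u q)) p v +
      christoffel (warpedMetric g.inner r) (graphMap u p)
        (v, vecDeriv 𝓘(ℝ, E) (fun q ↦ (u q : ℝ)) p v)
        (normalCoeff g r u p • modelGrad g.inner (fun q ↦ (u q : ℝ)) p,
          -(r (u p) ^ 2 * normalCoeff g r u p)) := by
  have hf : ContinuousAt (graphMap u) p := continuousAt_id.prodMk hu.continuous.continuousAt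
  have hneg (q : M) : -modelNormal g r u q =
      (normalCoeff g r u q • modelGrad g.inner (fun q ↦ (u q : ℝ)) q,
        -(r (u q) ^ 2 * normalCoeff g r u q)) := by
    rw [modelNormal_eq g hr_pos, Prod.neg_mk, neg_smul, neg_neg]
  have hF : ∀ᶠ q in nhds p, toCoord (𝓘(ℝ, E).prod 𝓘(ℝ, ℝ)) (graphMap u p) (graphMap u q)
      (-modelNormal g r u q) = (normalCoeff g r u q • gradCoord g (fun q ↦ (u q : ℝ)) p q,
        (-r (u q) ^ 2) • normalCoeff g r u q) := by
    filter_upwards [(chartAt E p).open_source.mem_nhds (mem_chart_source E p)] with q hq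
    rw [hneg, toCoord_graph p hq, map_smul, gradCoord, smul_eq_mul, neg_mul]
  rw [modelCovDeriv_apply _ hf _ hF, modelDeriv_graphMap (hu.mdifferentiable (by simp) p), hneg]

theorem trace_hessEndo (U : M → ℝ) (p : M) :
    LinearMap.trace ℝ E (hessEndo g U p : E →ₗ[ℝ] E) = laplacian g.inner U p :=
  rfl

/-- Replaces tangent spaces by the fixed model spaces, where the coordinate lemmas can be used for
rewriting. -/
theorem meanCurvature_graph_eq_metricTrace (p : M) :
    meanCurvature 𝓘(ℝ, E) (warpedMetric g.inner r) (graphMap u)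
        (fun q ↦ -graphNormal g.inner r u q) p =
      metricTrace
        (pullForm (modelForm (warpedMetric g.inner r) (graphMap u p))
          (modelDeriv 𝓘(ℝ, E) (𝓘(ℝ, E).prod 𝓘(ℝ, ℝ)) (graphMap u) p)
          (modelDeriv 𝓘(ℝ, E) (𝓘(ℝ, E).prod 𝓘(ℝ, ℝ)) (graphMap u) p))
        (-pullForm (modelForm (warpedMetric g.inner r) (graphMap u p))
          (modelCovDeriv (I := 𝓘(ℝ, E)) (warpedMetric g.inner r) (graphMap u)
            (fun q ↦ -modelNormal g r u q) p)
          (modelDeriv 𝓘(ℝ, E) (𝓘(ℝ, E).prod 𝓘(ℝ, ℝ)) (graphMap u) p)) :=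
  rfl

variable [FiniteDimensional ℝ E]

theorem vecDeriv_neg_normal (hr : ContDiffOn ℝ ∞ r J) (hr_pos : ∀ z ∈ J, 0 < r z)
    (hu : ContMDiff 𝓘(ℝ, E) 𝓘(ℝ, ℝ) ∞ u) (p : M) (v : E) :
    vecDeriv 𝓘(ℝ, E) (fun q ↦ (normalCoeff g r u q • gradCoord g (fun q ↦ (u q : ℝ)) p q,
        (-r (u q) ^ 2) • normalCoeff g r u q)) p v =
      (vecDeriv 𝓘(ℝ, E) (normalCoeff g r u) p v • modelGrad g.inner (fun q ↦ (u q : ℝ)) p +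
          normalCoeff g r u p • vecDeriv 𝓘(ℝ, E) (gradCoord g (fun q ↦ (u q : ℝ)) p) p v,
        -(vecDeriv 𝓘(ℝ, E) (fun q ↦ (u q : ℝ)) p v * (2 * r (u p) * deriv r (u p)) *
          normalCoeff g r u p + r (u p) ^ 2 * vecDeriv 𝓘(ℝ, E) (normalCoeff g r u) p v)) := by
  have hU : ContMDiff 𝓘(ℝ, E) 𝓘(ℝ, ℝ) ∞ (fun q ↦ (u q : ℝ)) := contMDiff_subtype_val.comp hu
  have hne : (∞ : ℕ∞ω) ≠ 0 := by simp
  have hU' := hU.mdifferentiable hne p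
  have hc := (contMDiff_normalCoeff g hr hr_pos hu).mdifferentiable hne p
  have hX := (contMDiffAt_gradCoord_infty g (hU p)).mdifferentiableAt hne
  have hr' : DifferentiableAt ℝ r (u p) :=
    (hr.contDiffAt (J.isOpen.mem_nhds (u p).2)).differentiableAt hne
  have hr2 : HasDerivAt (fun t ↦ -r t ^ 2) (-(2 * r (u p) * deriv r (u p))) (u p) := by
    simpa using (hr'.hasDerivAt.fun_pow 2).fun_neg
  have hs : MDifferentiableAt 𝓘(ℝ, E) 𝓘(ℝ, ℝ) (fun q ↦ -r (u q) ^ 2) p :=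
    DifferentiableAt.comp_mdifferentiableAt (f := fun q ↦ (u q : ℝ)) hr2.differentiableAt hU'
  have hs' := vecDeriv_comp (F := fun q ↦ (u q : ℝ)) hr2.hasFDerivAt hU'
  rw [vecDeriv_prodMk (F := fun q ↦ normalCoeff g r u q • gradCoord g (fun q ↦ (u q : ℝ)) p q)
      (F' := fun q ↦ (-r (u q) ^ 2) • normalCoeff g r u q) (hc.smul hX) (hs.smul hc),
    ContinuousLinearMap.prod_apply, vecDeriv_smul hc hX, vecDeriv_smul hs hc, hs', gradCoord_self]
  refine Prod.ext rfl ?_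
  simp only [ContinuousLinearMap.comp_apply, ContinuousLinearMap.toSpanSingleton_apply,
    smul_eq_mul]
  ring

/-- The two terms with `dc(v)` cancel because `g(X, w) = du(w)`. The mixed terms of the warped
Christoffel symbols cancel each other as well, leaving `-r³ r' c g(v, w)`; the `du ⊗ du` term comes
from differentiating `r²`. -/
theorem modelForm_modelCovDeriv_neg_normal (hr : ContDiffOn ℝ ∞ r J) (hr_pos : ∀ z ∈ J, 0 < r z)
    (hu : ContMDiff 𝓘(ℝ, E) 𝓘(ℝ, ℝ) ∞ u) (p : M) (v w : E) :
    modelForm (warpedMetric g.inner r) (graphMap u p)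
        (modelCovDeriv (I := 𝓘(ℝ, E)) (warpedMetric g.inner r) (graphMap u)
          (fun q ↦ -modelNormal g r u q) p v)
        (w, vecDeriv 𝓘(ℝ, E) (fun q ↦ (u q : ℝ)) p w) =
      normalCoeff g r u p * (r (u p) ^ 2 *
          modelForm g.inner p (hessEndo g (fun q ↦ (u q : ℝ)) p v) w -
        2 * r (u p) * deriv r (u p) * (vecDeriv 𝓘(ℝ, E) (fun q ↦ (u q : ℝ)) p v *
          vecDeriv 𝓘(ℝ, E) (fun q ↦ (u q : ℝ)) p w) -
        r (u p) ^ 3 * deriv r (u p) * modelForm g.inner p v w) := by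
  have hne : (∞ : ℕ∞ω) ≠ 0 := by simp
  have hr' : DifferentiableAt ℝ r (graphMap u p).2 :=
    (hr.contDiffAt (J.isOpen.mem_nhds (u p).2)).differentiableAt hne
  have hG := (contMDiffAt_metricCoeff_infty g (graphMap u p).1).mdifferentiableAt hne
  have hsymm : modelForm g.inner p v (modelGrad g.inner (fun q ↦ (u q : ℝ)) p) =
      modelForm g.inner p (modelGrad g.inner (fun q ↦ (u q : ℝ)) p) v := g.symm p _ _
  rw [modelCovDeriv_neg_normal g hr_pos hu, map_add, _root_.add_apply,
    modelForm_christoffel _ (isInvertible_warpedMetric g hr_pos _),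
    christoffelLower_warpedMetric hG hr', warpedMetric_apply, vecDeriv_neg_normal g hr hr_pos hu,
    hessEndo_apply]
  simp only [graphMap, map_add, map_smul, _root_.add_apply, _root_.smul_apply, smul_eq_mul]
  rw [modelForm_christoffel _ (isInvertible_inner g p), hsymm, inner_grad, inner_grad]
  ring

theorem meanCurvature_graph (hr : ContDiffOn ℝ ∞ r J) (hr_pos : ∀ z ∈ J, 0 < r z)
    (hu : ContMDiff 𝓘(ℝ, E) 𝓘(ℝ, ℝ) ∞ u) (p : M) :
    meanCurvature 𝓘(ℝ, E) (warpedMetric g.inner r) (graphMap u)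
        (fun q ↦ -graphNormal g.inner r u q) p =
      -(1 / (r (u p) * graphW g.inner r u p)) * laplacian g.inner (fun q ↦ (u q : ℝ)) p
        + 1 / (2 * r (u p) * graphW g.inner r u p ^ 3) *
            g.inner p (grad g.inner (gradSq g.inner (fun q ↦ (u q : ℝ))) p)
              (grad g.inner (fun q ↦ (u q : ℝ)) p)
        + deriv r (u p) / graphW g.inner r u p ^ 3 * gradSq g.inner (fun q ↦ (u q : ℝ)) p
        + Module.finrank ℝ E * (deriv r (u p) / graphW g.inner r u p) := by
  have hU : ContMDiff 𝓘(ℝ, E) 𝓘(ℝ, ℝ) ∞ (fun q ↦ (u q : ℝ)) := contMDiff_subtype_val.comp hu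
  have hu' : MDifferentiableAt 𝓘(ℝ, E) 𝓘(ℝ, ℝ) u p := hu.mdifferentiable (by simp) p
  have hρ := hr_pos _ (u p).2
  have hW := graphW_pos g hr_pos (u := u) p
  have hW2 := graphW_sq g hr_pos (u := u) p
  set U : M → ℝ := fun q ↦ (u q : ℝ)
  set X := modelGrad g.inner U p
  set α := vecDeriv 𝓘(ℝ, E) U p
  set c := normalCoeff g r u p
  set ρ := r (u p)
  set ρ' := deriv r (u p)
  have hX : modelForm g.inner p X = α := ContinuousLinearMap.ext (inner_grad g U p)
  have hαX : α X = gradSq g.inner U p := by rw [← hX, gradSq_eq]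
  -- `A` is the second fundamental form with an index raised by `g` rather than by the induced
  -- metric; its signs are opposite to those of the pairing just computed because of the minus in
  -- the definition of the form.
  let A : E →L[ℝ] E := (-(c * ρ ^ 2)) • hessEndo g U p + (2 * c * ρ * ρ') • α.smulRight X +
    (c * ρ ^ 3 * ρ') • ContinuousLinearMap.id ℝ E
  have hB : pullForm (modelForm (warpedMetric g.inner r) (graphMap u p))
      (modelDeriv 𝓘(ℝ, E) (𝓘(ℝ, E).prod 𝓘(ℝ, ℝ)) (graphMap u) p)
      (modelDeriv 𝓘(ℝ, E) (𝓘(ℝ, E).prod 𝓘(ℝ, ℝ)) (graphMap u) p) =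
        ρ ^ 2 • modelForm g.inner p + α.smulRight α := by
    ext v w
    rw [pullForm_apply, modelDeriv_graphMap hu', modelDeriv_graphMap hu', warpedMetric_apply]
    rfl
  have hh : -pullForm (modelForm (warpedMetric g.inner r) (graphMap u p))
      (modelCovDeriv (I := 𝓘(ℝ, E)) (warpedMetric g.inner r) (graphMap u)
        (fun q ↦ -modelNormal g r u q) p)
      (modelDeriv 𝓘(ℝ, E) (𝓘(ℝ, E).prod 𝓘(ℝ, ℝ)) (graphMap u) p) = modelForm g.inner p ∘L A := by
    ext v w
    rw [_root_.neg_apply, _root_.neg_apply, pullForm_apply, modelDeriv_graphMap hu',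
      modelForm_modelCovDeriv_neg_normal g hr hr_pos hu]
    simp only [A, ContinuousLinearMap.comp_apply, map_add, map_smul, _root_.add_apply,
      _root_.smul_apply, ContinuousLinearMap.smulRight_apply, ContinuousLinearMap.id_apply, hX,
      smul_eq_mul]
    ring
  -- The Sherman–Morrison denominator is exactly `w²`.
  have hpos : ρ ^ 2 + α X ≠ 0 := by
    rw [hαX, ← hW2]
    positivity
  have htrace : LinearMap.trace ℝ E (A : E →ₗ[ℝ] E) = -(c * ρ ^ 2) * laplacian g.inner U p +
      2 * c * ρ * ρ' * α X + c * ρ ^ 3 * ρ' * Module.finrank ℝ E := by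
    have hA : (A : E →ₗ[ℝ] E) = (-(c * ρ ^ 2)) • (hessEndo g U p : E →ₗ[ℝ] E) +
        (2 * c * ρ * ρ') • (α : E →ₗ[ℝ] ℝ).smulRight X +
        (c * ρ ^ 3 * ρ') • LinearMap.id := rfl
    rw [hA, map_add, map_add, map_smul, map_smul, map_smul, LinearMap.trace_smulRight,
      LinearMap.trace_id, trace_hessEndo]
    rfl
  have hHess : 2 * α (hessEndo g U p X) =
      modelForm g.inner p (modelGrad g.inner (gradSq g.inner U) p) X := by
    rw [inner_grad]
    have : IsManifold 𝓘(ℝ, E) (∞ + 1) M := ‹_›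
    have h1 := inner_hessEndo_grad (n := ∞) g (by simp) (hU p) X
    refine Eq.trans ?_ h1.symm
    have h2 : modelForm g.inner p (hessEndo g U p X) X =
      modelForm g.inner p X (hessEndo g U p X) := g.symm p _ _
    rw [h2, hX]
  have hαA : α (A X) = -(c * ρ ^ 2) * α (hessEndo g U p X) + 2 * c * ρ * ρ' * (α X * α X) +
      c * ρ ^ 3 * ρ' * α X := by
    simp [A]
  have hgoal : g.inner p (grad g.inner (gradSq g.inner U) p) (grad g.inner U p) =
      2 * α (hessEndo g U p X) := hHess.symm
  rw [meanCurvature_graph_eq_metricTrace g, metricTrace_rank_one (isInvertible_inner g p) hX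
    (pow_pos hρ 2).ne' hpos hB hh, htrace, hαA, hgoal, hαX, ← hW2]
  -- Eliminating `|grad u|²` in favour of `w² - ρ²` leaves a rational identity with denominators in
  -- `ρ` and `w`.
  have hs : gradSq g.inner U p = graphW g.inner r u p ^ 2 - ρ ^ 2 := by rw [hW2]; ring
  have hc : c = 1 / (ρ * graphW g.inner r u p) := rfl
  rw [hs, hc]
  have := hρ.ne'
  have := hW.ne'
  field_simp
  ring

end GraphCurvature

end WarpedGraph

open WarpedGraph in
theorem lemma2p2 (n : ℕ) {M : Type*} [TopologicalSpace M] [T2Space M] [CompactSpace M]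
    [ChartedSpace (EuclideanSpace ℝ (Fin n)) M]
    [IsManifold 𝓘(ℝ, EuclideanSpace ℝ (Fin n)) ∞ M]
    (g : Bundle.ContMDiffRiemannianMetric 𝓘(ℝ, EuclideanSpace ℝ (Fin n)) ∞ (EuclideanSpace ℝ (Fin n))
      (fun x : M ↦ TangentSpace 𝓘(ℝ, EuclideanSpace ℝ (Fin n)) x))
    (J : TopologicalSpace.Opens ℝ) (hJ : (J : Set ℝ).OrdConnected)
    (r : ℝ → ℝ) (hr : ContDiffOn ℝ ∞ r J) (hr_pos : ∀ z ∈ J, 0 < r z)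
    (u : M → J) (hu : ContMDiff 𝓘(ℝ, EuclideanSpace ℝ (Fin n)) 𝓘(ℝ, ℝ) ∞ u) :
    IsUnitNormalAlong 𝓘(ℝ, EuclideanSpace ℝ (Fin n)) (warpedMetric g.inner r) (graphMap u)
        (graphNormal g.inner r u) ∧
      (∀ p, 0 < dz (graphMap u p) (graphNormal g.inner r u p)) ∧
      ∀ p, meanCurvature 𝓘(ℝ, EuclideanSpace ℝ (Fin n)) (warpedMetric g.inner r) (graphMap u)
          (fun q ↦ -graphNormal g.inner r u q) p =
        -(1 / (r (u p) * graphW g.inner r u p)) * laplacian g.inner (fun q ↦ (u q : ℝ)) p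
          + 1 / (2 * r (u p) * graphW g.inner r u p ^ 3) *
              g.inner p (grad g.inner (gradSq g.inner (fun q ↦ (u q : ℝ))) p)
                (grad g.inner (fun q ↦ (u q : ℝ)) p)
          + deriv r (u p) / graphW g.inner r u p ^ 3 * gradSq g.inner (fun q ↦ (u q : ℝ)) p
          + n * (deriv r (u p) / graphW g.inner r u p) := by
  refine ⟨isUnitNormalAlong_graphNormal g hr hr_pos hu, dz_graphNormal_pos g hr_pos, fun p ↦ ?_⟩
  rw [meanCurvature_graph g hr hr_pos hu p, finrank_euclideanSpace_fin]
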